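/- Let $\beta=\log_2(3/2)$, let $Q_n$ be the $n$-dimensional Hamming cube with vertex set $V=\{0,1\}^n$ (two vertices being adjacent when they differ in exactly one coordinate), let $\mu$ be the uniform probability measure on $V$, and for disjoint $A,B\subseteq V$ let $\nabla(A,B)$ be the set of edges $(x,y)$ of $Q_n$ with $x\in A$ and $y\in B$. There is an absolute constant $C>0$ such that the following holds for every $k\in\{1,2\}$, every $n\ge 1$ and every $\varepsilon>0$. If $(A,B,W)$ is a partition of $V$ (parts may be empty) with $$(1-\varepsilon)2^{-k}\le \mu(A)\le (1+\varepsilon)2^{-k},\qquad \mu(W)\le \varepsilon n^{-\beta},\qquad |\nabla(A,B)|<(1+\varepsilon)k2^{n-k},$$ then $$|\nabla(A,B)|>(1-C\varepsilon)k2^{n-k}.$$ -/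

import Mathlib

/-- The `n`-dimensional Hamming cube `Q_n`: vertices are the 0/1 strings of length `n`, and two
strings are adjacent when they differ in exactly one coordinate. -/
def hammingCube (n : ℕ) : SimpleGraph (Fin n → Bool) where
  Adj x y := hammingDist x y = 1
  symm := ⟨fun x y h => by rw [hammingDist_comm]; exact h⟩
  loopless := ⟨fun x h => by simp at h⟩

instance (n : ℕ) : DecidableRel (hammingCube n).Adj :=
  fun x y => inferInstanceAs (Decidable (hammingDist x y = 1))

/-- The uniform probability measure of a set of vertices of the cube. -/
noncomputable def cubeMeasure {n : ℕ} (A : Finset (Fin n → Bool)) : ℝ :=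
  (A.card : ℝ) / 2 ^ n

/-- `(A, B, W)` is a partition of the vertex set of the cube (parts may be empty). -/
def IsCubePartition {n : ℕ} (A B W : Finset (Fin n → Bool)) : Prop :=
  Disjoint A B ∧ Disjoint A W ∧ Disjoint B W ∧ A ∪ B ∪ W = Finset.univ

/-- The set `∇(A, B)` of edges `(x, y)` of the cube with `x ∈ A` and `y ∈ B`. -/
def edgesBetween {n : ℕ} (A B : Finset (Fin n → Bool)) :
    Finset ((Fin n → Bool) × (Fin n → Bool)) :=
  (hammingCube n).interedges A B

/-! Write h(x) for the number of neighbours of x outside a set S. The engine is `isoperimetric`: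
2μ(S)(1 - μ(S)) is at most the integral of h^β over S. Since 2^β = 3/2, subcubes of codimension 1
and 2, where h is constantly 1 and 2, give equality.

It is proved by induction on n. If the two facet sections have measures a ≥ b, the induction closes
once the larger section gains (a - b)² from its edges to the other facet; `two_point_bound` supplies
this.

For the theorem take S = A ∪ W. The points of W contribute at most μ(W)n^β ≤ ε, and on A the
integral of h itself counts ∇(A, B). A linear upper bound for t^β that is exact at t = k turns the
β-th moment into the edge count. -/

/-! ### Real inequalities for the exponent β -/

/-- The exponent `log₂ (3/2)`. -/
noncomputable def isoExponent : ℝ := Real.logb 2 (3 / 2)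

theorem two_rpow_isoExponent : (2 : ℝ) ^ isoExponent = 3 / 2 :=
  Real.rpow_logb (by norm_num) (by norm_num) (by norm_num)

theorem half_lt_isoExponent : 1 / 2 < isoExponent := by
  rw [isoExponent, Real.lt_logb_iff_rpow_lt (by norm_num) (by norm_num), ← Real.sqrt_eq_rpow,
    Real.sqrt_lt' (by norm_num)]
  norm_num

theorem isoExponent_lt_one : isoExponent < 1 := by
  rw [isoExponent, Real.logb_lt_iff_lt_rpow (by norm_num) (by norm_num)]
  norm_num

theorem isoExponent_pos : 0 < isoExponent := by linarith [half_lt_isoExponent]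

theorem one_le_inv_isoExponent : 1 ≤ isoExponent⁻¹ :=
  (one_le_inv₀ isoExponent_pos).2 isoExponent_lt_one.le

theorem inv_isoExponent_le_two : isoExponent⁻¹ ≤ 2 := by
  rw [inv_le_comm₀ isoExponent_pos two_pos]
  linarith [half_lt_isoExponent]

theorem three_halves_rpow_inv_isoExponent : (3 / 2 : ℝ) ^ isoExponent⁻¹ = 2 := by
  rw [← two_rpow_isoExponent, Real.rpow_rpow_inv (by norm_num) isoExponent_pos.ne']

/-- Increments of the concave function `t ↦ t ^ β` over unit intervals decrease. -/
theorem rpow_add_half_le_one_add_rpow {y : ℝ} (hy : 0 ≤ y) (hy1 : y ≤ 1) :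
    y ^ isoExponent + 1 / 2 ≤ (1 + y) ^ isoExponent := by
  have hc := Real.concaveOn_rpow isoExponent_pos.le isoExponent_lt_one.le
  have h2 : 0 < 2 - y := by linarith
  have ha : (0 : ℝ) ≤ 1 / (2 - y) := by positivity
  have hb : (0 : ℝ) ≤ (1 - y) / (2 - y) := div_nonneg (by linarith) h2.le
  have hab : 1 / (2 - y) + (1 - y) / (2 - y) = 1 := by field_simp; ring
  -- 1 and 1 + y are convex combinations of y and 2 with swapped weights; adding the two concavity
  -- bounds gives y^β + 2^β ≤ 1 + (1 + y)^β.
  have h₁ := hc.2 (Set.mem_Ici.2 hy) (Set.mem_Ici.2 zero_le_two) ha hb hab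
  have h₂ := hc.2 (Set.mem_Ici.2 hy) (Set.mem_Ici.2 zero_le_two) hb ha (by rw [add_comm, hab])
  simp only [smul_eq_mul, two_rpow_isoExponent] at h₁ h₂
  have e₁ : 1 / (2 - y) * y + (1 - y) / (2 - y) * 2 = 1 := by field_simp; ring
  have e₂ : (1 - y) / (2 - y) * y + 1 / (2 - y) * 2 = 1 + y := by field_simp; ring
  rw [e₁, Real.one_rpow] at h₁
  rw [e₂] at h₂
  generalize 1 / (2 - y) = a at *
  generalize (1 - y) / (2 - y) = b at *
  have : b = 1 - a := by linarith
  subst this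
  nlinarith

theorem one_add_half_rpow_le_rpow_add_one (h : ℕ) :
    1 + (h : ℝ) ^ isoExponent / 2 ≤ ((h : ℝ) + 1) ^ isoExponent := by
  rcases Nat.eq_zero_or_pos h with rfl | hh
  · simp [Real.zero_rpow isoExponent_pos.ne']
  · have hp : (0 : ℝ) < h := by exact_mod_cast hh
    have h1 : (1 : ℝ) ≤ h := by exact_mod_cast hh
    have key := rpow_add_half_le_one_add_rpow (inv_nonneg.2 hp.le) (inv_le_one_of_one_le₀ h1)
    have hpow : 0 < (h : ℝ) ^ isoExponent := Real.rpow_pos_of_pos hp _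
    have e : (h : ℝ) + 1 = h * (1 + (h : ℝ)⁻¹) := by field_simp
    rw [e, Real.mul_rpow hp.le (by positivity)]
    rw [Real.inv_rpow hp.le] at key
    have := mul_le_mul_of_nonneg_left key hpow.le
    rw [mul_add, mul_inv_cancel₀ hpow.ne'] at this
    linarith

/-- Minkowski's inequality for sums of vectors in the plane with the `ℓᵖ` norm. -/
theorem rpow_sum_add_rpow_sum_le {ι : Type*} (s : Finset ι) (f g : ι → ℝ) {p : ℝ} (hp : 1 ≤ p)
    (hf : ∀ i ∈ s, 0 ≤ f i) (hg : ∀ i ∈ s, 0 ≤ g i) :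
    ((∑ i ∈ s, f i) ^ p + (∑ i ∈ s, g i) ^ p) ^ (1 / p) ≤
      ∑ i ∈ s, (f i ^ p + g i ^ p) ^ (1 / p) := by
  classical
  have hp0 : 0 < p := by linarith
  induction s using Finset.induction_on with
  | empty => simp [Real.zero_rpow hp0.ne', Real.zero_rpow (inv_pos.2 hp0).ne']
  | insert a s ha ih =>
    have hfs : ∀ i ∈ s, 0 ≤ f i := fun i hi => hf i (Finset.mem_insert_of_mem hi)
    have hgs : ∀ i ∈ s, 0 ≤ g i := fun i hi => hg i (Finset.mem_insert_of_mem hi)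
    have hfa := hf a (Finset.mem_insert_self a s)
    have hga := hg a (Finset.mem_insert_self a s)
    have h := Real.Lp_add_le_of_nonneg (s := Finset.univ) (f := ![f a, g a])
      (g := ![∑ i ∈ s, f i, ∑ i ∈ s, g i]) hp
      (by intro i _; fin_cases i <;> simpa)
      (by intro i _; fin_cases i <;> simp [Finset.sum_nonneg hfs, Finset.sum_nonneg hgs])
    simp only [Fin.sum_univ_two, Matrix.cons_val_zero, Matrix.cons_val_one] at h
    rw [Finset.sum_insert ha, Finset.sum_insert ha, Finset.sum_insert ha]
    exact h.trans (by gcongr; exact ih hfs hgs)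


/-- Increments of the convex function `t ↦ t ^ p` increase. -/
theorem add_rpow_add_rpow_le {p x y e : ℝ} (hp : 1 ≤ p) (hx : 0 ≤ x) (hxy : x ≤ y) (he : 0 < e) :
    (x + e) ^ p + y ^ p ≤ x ^ p + (y + e) ^ p := by
  have hc := convexOn_rpow hp
  have hd : 0 < y - x + e := by linarith
  have ha : 0 ≤ e / (y - x + e) := by positivity
  have hb : 0 ≤ (y - x) / (y - x + e) := div_nonneg (by linarith) hd.le
  have hab : e / (y - x + e) + (y - x) / (y - x + e) = 1 := by field_simp; ring
  have hye : y + e ∈ Set.Ici (0 : ℝ) := Set.mem_Ici.2 (by linarith)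
  have h₁ := hc.2 (Set.mem_Ici.2 hx) hye ha hb hab
  have h₂ := hc.2 (Set.mem_Ici.2 hx) hye hb ha (by rw [add_comm, hab])
  simp only [smul_eq_mul] at h₁ h₂
  have e₁ : e / (y - x + e) * x + (y - x) / (y - x + e) * (y + e) = y := by field_simp; ring
  have e₂ : (y - x) / (y - x + e) * x + e / (y - x + e) * (y + e) = x + e := by field_simp; ring
  rw [e₁] at h₁
  rw [e₂] at h₂
  generalize e / (y - x + e) = a at *
  generalize (y - x) / (y - x + e) = b at *
  have : b = 1 - a := by linarith
  subst this
  nlinarith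

/-- The two-point inequality behind the isoperimetric inequality, for small increments. -/
theorem add_sq_rpow_le {f d : ℝ} (hf : 0 ≤ f) (hf2 : f ≤ 1 / 2) (hd : 0 ≤ d) (hd2 : d ≤ 1 / 2) :
    (f + d ^ 2) ^ isoExponent⁻¹ ≤ f ^ isoExponent⁻¹ + d ^ isoExponent⁻¹ := by
  have hp0 : (0 : ℝ) < isoExponent⁻¹ := inv_pos.2 isoExponent_pos
  rcases hd.eq_or_lt with rfl | hd0
  · simp [Real.zero_rpow hp0.ne']
  -- With p = 1/β, the increment of t^p over a step d² is largest at f = 1/2. There the chord over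
  -- [1/2, 3/4] bounds it by (2d)²(1/2)^p, because (3/2)^p = 2; finally p ≤ 2 and 2d ≤ 1.
  have h₁ := add_rpow_add_rpow_le one_le_inv_isoExponent hf hf2 (pow_pos hd0 2)
  have h₂ := (convexOn_rpow one_le_inv_isoExponent).2
    (Set.mem_Ici.2 (by norm_num : (0 : ℝ) ≤ 1 / 2)) (Set.mem_Ici.2 (by norm_num : (0 : ℝ) ≤ 3 / 4))
    (by nlinarith : 0 ≤ 1 - (2 * d) ^ 2) (by positivity : 0 ≤ (2 * d) ^ 2) (by ring)
  simp only [smul_eq_mul] at h₂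
  have e₁ : (1 - (2 * d) ^ 2) * (1 / 2) + (2 * d) ^ 2 * (3 / 4) = 1 / 2 + d ^ 2 := by ring
  have e₂ : (3 / 4 : ℝ) ^ isoExponent⁻¹ = 2 * (1 / 2) ^ isoExponent⁻¹ := by
    have h := Real.mul_rpow (x := 3 / 2) (y := 1 / 2) (z := isoExponent⁻¹) (by norm_num)
      (by norm_num)
    rw [three_halves_rpow_inv_isoExponent] at h
    rw [← h]
    norm_num
  have e₃ : d ^ isoExponent⁻¹ = (2 * d) ^ isoExponent⁻¹ * (1 / 2) ^ isoExponent⁻¹ := by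
    rw [← Real.mul_rpow (by positivity) (by norm_num)]
    congr 1; ring
  have h₃ : (2 * d) ^ 2 ≤ (2 * d) ^ isoExponent⁻¹ := by
    rw [← Real.rpow_natCast]
    exact Real.rpow_le_rpow_of_exponent_ge (by positivity) (by linarith)
      (by exact_mod_cast inv_isoExponent_le_two)
  have h₄ : (0 : ℝ) ≤ (1 / 2) ^ isoExponent⁻¹ := by positivity
  rw [e₁, e₂] at h₂
  rw [e₃]
  nlinarith [mul_le_mul_of_nonneg_right h₃ h₄]

/-- Neither lower bound on X suffices alone. The linear one handles a - b ≥ 1 - a; otherwise a - b ≤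
1/2 and the ℓ^(1/β) one applies through `add_sq_rpow_le`. -/
theorem two_point_bound {a b I U X : ℝ} (hb : 0 ≤ b) (hba : b ≤ a) (ha : a ≤ 1)
    (hI : 2 * a * (1 - a) ≤ I) (hU : a - b ≤ U)
    (h₁ : (I ^ isoExponent⁻¹ + U ^ isoExponent⁻¹) ^ isoExponent ≤ X) (h₂ : U + I / 2 ≤ X) :
    2 * a * (1 - a) + (a - b) ^ 2 ≤ X := by
  have hp0 : (0 : ℝ) < isoExponent⁻¹ := inv_pos.2 isoExponent_pos
  have hf : 0 ≤ 2 * a * (1 - a) := mul_nonneg (by linarith) (by linarith)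
  by_cases hd : 1 - a ≤ a - b
  -- With d = a - b, the slack d(1 - d) - a(1 - a) equals b(a + d - 1).
  · nlinarith [mul_nonneg hb (sub_nonneg.2 hd)]
  · have key := add_sq_rpow_le hf (by nlinarith [sq_nonneg (2 * a - 1)]) (sub_nonneg.2 hba)
      (by linarith)
    have hs : 0 ≤ 2 * a * (1 - a) + (a - b) ^ 2 := by positivity
    have h := Real.rpow_le_rpow (by positivity) (key.trans (add_le_add
      (Real.rpow_le_rpow hf hI hp0.le) (Real.rpow_le_rpow (sub_nonneg.2 hba) hU hp0.le)))
      isoExponent_pos.le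
    rw [Real.rpow_inv_rpow hs isoExponent_pos.ne'] at h
    exact h.trans h₁

/-- Gain in the `β`-th moment of a degree function on `S` when the points outside `T` get one
further boundary edge. -/
theorem boundary_gain {α : Type*} [DecidableEq α] (S T : Finset α) (h : α → ℕ) {N : ℝ}
    (hN : 0 < N) (hTS : T.card ≤ S.card) (hSN : (S.card : ℝ) ≤ N)
    (hI : 2 * (S.card / N) * (1 - S.card / N) ≤ (∑ x ∈ S, (h x : ℝ) ^ isoExponent) / N) :
    2 * (S.card / N) * (1 - S.card / N) + (S.card / N - T.card / N) ^ 2 ≤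
      (∑ x ∈ S, ((h x + if x ∈ T then 0 else 1 : ℕ) : ℝ) ^ isoExponent) / N := by
  have hβ := isoExponent_pos
  have hU : ∑ x ∈ S, (if x ∈ T then (0 : ℝ) else 1) = (S \ T).card := by
    rw [Finset.card_eq_sum_ones, ← Finset.filter_notMem_eq_sdiff, Finset.sum_filter]
    push_cast
    exact Finset.sum_congr rfl fun x _ => by split_ifs <;> simp_all
  refine two_point_bound (U := (S \ T).card / N) (by positivity) (by gcongr)
    ((div_le_one hN).2 hSN) hI ?_ ?_ ?_
  · rw [← sub_div]
    gcongr
    rw [sub_le_iff_le_add]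
    exact_mod_cast Finset.card_le_card_sdiff_add_card
  -- (h + 1)^β is the ℓ^(1/β) norm of the vector (h^β, 1), so Minkowski applies.
  · have hm := rpow_sum_add_rpow_sum_le S (fun x => (h x : ℝ) ^ isoExponent)
      (fun x => if x ∈ T then 0 else 1) one_le_inv_isoExponent (fun _ _ => by positivity)
      (fun _ _ => by split_ifs <;> norm_num)
    rw [hU] at hm
    simp only [one_div, inv_inv] at hm
    have hsum : 0 ≤ ∑ x ∈ S, (h x : ℝ) ^ isoExponent := Finset.sum_nonneg fun _ _ => by positivity
    rw [Real.div_rpow hsum hN.le, Real.div_rpow (by positivity) hN.le, ← add_div,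
      Real.div_rpow (by positivity) (by positivity), Real.rpow_inv_rpow hN.le hβ.ne']
    gcongr
    refine hm.trans (Finset.sum_le_sum fun x _ => ?_)
    rw [Real.rpow_rpow_inv (by positivity) hβ.ne']
    split_ifs
    · simp [Real.zero_rpow (inv_pos.2 hβ).ne']
    · simp
  · rw [div_right_comm, ← add_div, ← hU, Finset.sum_div, ← Finset.sum_add_distrib]
    gcongr with x hx
    split_ifs
    · have : (0 : ℝ) ≤ (h x : ℝ) ^ isoExponent := by positivity
      simp only [add_zero, zero_add]
      linarith
    · push_cast
      exact one_add_half_rpow_le_rpow_add_one (h x)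

/-! ### Sections of the cube and the isoperimetric inequality -/

/-- The neighbour of `x` in direction `i`. -/
def cubeFlip {n : ℕ} (x : Fin n → Bool) (i : Fin n) : Fin n → Bool :=
  Function.update x i (!x i)

/-- The number of neighbours of `x` outside `A`. -/
def outDegree {n : ℕ} (A : Finset (Fin n → Bool)) (x : Fin n → Bool) : ℕ :=
  ∑ i, if cubeFlip x i ∈ A then 0 else 1

/-- The part of `A` in a facet of the cube. -/
def cubeSection {n : ℕ} (A : Finset (Fin (n + 1) → Bool)) (b : Bool) : Finset (Fin n → Bool) :=
  Finset.univ.filter fun x => (Fin.cons b x : Fin (n + 1) → Bool) ∈ A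

theorem outDegree_cons {n : ℕ} (A : Finset (Fin (n + 1) → Bool)) (b : Bool) (x : Fin n → Bool) :
    outDegree A (Fin.cons b x : Fin (n + 1) → Bool) =
      outDegree (cubeSection A b) x + if x ∈ cubeSection A (!b) then 0 else 1 := by
  simp [outDegree, cubeSection, cubeFlip, Fin.sum_univ_succ, Fin.cons_update, add_comm]

theorem sum_eq_sum_cubeSection {n : ℕ} (A : Finset (Fin (n + 1) → Bool))
    (f : (Fin (n + 1) → Bool) → ℝ) :
    ∑ x ∈ A, f x = ∑ b, ∑ x ∈ cubeSection A b, f (Fin.cons b x : Fin (n + 1) → Bool) := by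
  have h : ∑ x ∈ A, f x = ∑ x, if x ∈ A then f x else 0 := by simp
  rw [h, ← (Fin.consEquiv fun _ => Bool).sum_comp, Fintype.sum_prod_type]
  simp [cubeSection, Finset.sum_filter, Fin.consEquiv]
  rfl

theorem cubeMeasure_le_one {n : ℕ} (A : Finset (Fin n → Bool)) : cubeMeasure A ≤ 1 := by
  rw [cubeMeasure, div_le_one (by positivity)]
  exact_mod_cast (Finset.card_le_univ A).trans_eq (by simp)

/-- The isoperimetric inequality of Kahn and Park. -/
theorem isoperimetric (n : ℕ) (A : Finset (Fin n → Bool)) :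
    2 * cubeMeasure A * (1 - cubeMeasure A) ≤
      (∑ x ∈ A, (outDegree A x : ℝ) ^ isoExponent) / 2 ^ n := by
  induction n with
  | zero =>
    have h : A.card = 0 ∨ A.card = 1 := by
      have : A.card ≤ 1 := (Finset.card_le_univ A).trans_eq (by simp)
      omega
    have hr : 0 ≤ (∑ x ∈ A, (outDegree A x : ℝ) ^ isoExponent) / 2 ^ 0 := by positivity
    rcases h with h | h <;> simpa [cubeMeasure, h] using hr
  | succ n ih =>
    have key : ∀ b : Bool, (cubeSection A (!b)).card ≤ (cubeSection A b).card →
        2 * cubeMeasure A * (1 - cubeMeasure A) ≤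
          (∑ x ∈ A, (outDegree A x : ℝ) ^ isoExponent) / 2 ^ (n + 1) := by
      intro b hb
      have hN : (0 : ℝ) < 2 ^ n := by positivity
      have h₁ := boundary_gain (cubeSection A b) (cubeSection A (!b))
        (outDegree (cubeSection A b)) hN hb
        ((div_le_one hN).1 (cubeMeasure_le_one (cubeSection A b))) (ih _)
      -- For the smaller section the edges across the facets can be dropped.
      have h₂ : (∑ x ∈ cubeSection A (!b),
          (outDegree (cubeSection A (!b)) x : ℝ) ^ isoExponent) / 2 ^ n ≤
          (∑ x ∈ cubeSection A (!b), ((outDegree (cubeSection A (!b)) x +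
            if x ∈ cubeSection A b then 0 else 1 : ℕ) : ℝ) ^ isoExponent) / 2 ^ n := by
        gcongr
        · exact isoExponent_pos.le
        · omega
      have h₃ := (ih (cubeSection A (!b))).trans h₂
      have hcard : cubeMeasure A =
          (cubeMeasure (cubeSection A b) + cubeMeasure (cubeSection A (!b))) / 2 := by
        have := sum_eq_sum_cubeSection A fun _ => 1
        simp only [Finset.sum_const, nsmul_eq_mul, mul_one, Fintype.sum_bool] at this
        rw [cubeMeasure, this, cubeMeasure, cubeMeasure, pow_succ]
        cases b <;> simp only [Bool.not_true, Bool.not_false] <;> field_simp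
        exact add_comm _ _
      have hsum : (∑ x ∈ A, (outDegree A x : ℝ) ^ isoExponent) / 2 ^ (n + 1) =
          ((∑ x ∈ cubeSection A b, ((outDegree (cubeSection A b) x +
            if x ∈ cubeSection A (!b) then 0 else 1 : ℕ) : ℝ) ^ isoExponent) / 2 ^ n +
          (∑ x ∈ cubeSection A (!b), ((outDegree (cubeSection A (!b)) x +
            if x ∈ cubeSection A b then 0 else 1 : ℕ) : ℝ) ^ isoExponent) / 2 ^ n) / 2 := by
        rw [sum_eq_sum_cubeSection, Fintype.sum_bool]
        simp only [outDegree_cons]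
        rw [pow_succ]
        cases b <;> simp only [Bool.not_true, Bool.not_false] <;> field_simp
        exact add_comm _ _
      rw [hsum, hcard]
      simp only [cubeMeasure] at h₃ ⊢
      -- The mean of 2a(1 - a) + (a - b)² and 2b(1 - b) is exactly 2m(1 - m) with m = (a + b)/2.
      linarith
    rcases le_total (cubeSection A true).card (cubeSection A false).card with h | h
    · exact key false h
    · exact key true h

/-! ### Edge counts as sums of out-degrees -/

theorem hammingDist_eq_one_iff {n : ℕ} (x y : Fin n → Bool) :
    hammingDist x y = 1 ↔ ∃ i, cubeFlip x i = y := by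
  rw [hammingDist, Finset.card_eq_one]
  refine exists_congr fun i => ⟨fun h => ?_, ?_⟩
  · have hj : ∀ j, x j ≠ y j ↔ j = i := fun j => by
      rw [← Finset.mem_singleton, ← h]
      simp
    funext j
    by_cases hji : j = i
    · subst hji
      have := (hj j).2 rfl
      simp only [cubeFlip, Function.update_self]
      revert this
      cases x j <;> cases y j <;> simp
    · simp only [cubeFlip, Function.update_of_ne hji]
      exact not_not.1 (mt (hj j).1 hji)
  · rintro rfl
    ext j
    rw [Finset.mem_filter, Finset.mem_singleton]
    by_cases hji : j = i
    · subst hji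
      simp [cubeFlip]
    · simp [cubeFlip, hji]

theorem cubeFlip_injective {n : ℕ} (x : Fin n → Bool) : Function.Injective (cubeFlip x) := by
  intro i j h
  by_contra hij
  have := congrFun h i
  simp [cubeFlip, hij] at this

theorem card_edgesBetween {n : ℕ} (A B : Finset (Fin n → Bool)) :
    (edgesBetween A B).card = ∑ x ∈ A, ∑ i, if cubeFlip x i ∈ B then 1 else 0 := by
  rw [edgesBetween, SimpleGraph.interedges_def, Finset.card_filter, Finset.sum_product]
  refine Finset.sum_congr rfl fun x _ => ?_
  rw [← Finset.card_filter, ← Finset.card_filter,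
    ← Finset.card_image_of_injective _ (cubeFlip_injective x)]
  congr 1
  ext y
  simp only [hammingCube, hammingDist_eq_one_iff, Finset.mem_filter, Finset.mem_image,
    Finset.mem_univ, true_and]
  constructor
  · rintro ⟨hy, i, rfl⟩
    exact ⟨i, hy, rfl⟩
  · rintro ⟨i, hi, rfl⟩
    exact ⟨hi, i, rfl⟩

theorem IsCubePartition.card_edgesBetween {n : ℕ} {A B W : Finset (Fin n → Bool)}
    (h : IsCubePartition A B W) :
    (edgesBetween A B).card = ∑ x ∈ A, outDegree (A ∪ W) x := by
  obtain ⟨hAB, -, hBW, hu⟩ := h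
  rw [_root_.card_edgesBetween]
  refine Finset.sum_congr rfl fun x _ => Finset.sum_congr rfl fun i _ => ?_
  have hmem : cubeFlip x i ∈ A ∪ B ∪ W := hu ▸ Finset.mem_univ _
  have h₁ : cubeFlip x i ∈ A → cubeFlip x i ∉ B := fun h => Finset.disjoint_left.1 hAB h
  have h₂ : cubeFlip x i ∈ B → cubeFlip x i ∉ W := fun h => Finset.disjoint_left.1 hBW h
  simp only [Finset.mem_union] at hmem ⊢
  split_ifs <;> tauto

theorem outDegree_le {n : ℕ} (A : Finset (Fin n → Bool)) (x : Fin n → Bool) :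
    outDegree A x ≤ n := by
  refine (Finset.sum_le_card_nsmul _ _ 1 fun i _ => ?_).trans_eq (by simp)
  split_ifs <;> simp

/-- The isoperimetric inequality for `A ∪ W`, with the contribution of `W` estimated trivially. -/
theorem IsCubePartition.isoperimetric {n : ℕ} {A B W : Finset (Fin n → Bool)}
    (h : IsCubePartition A B W) :
    2 * (cubeMeasure A + cubeMeasure W) * (1 - (cubeMeasure A + cubeMeasure W)) ≤
      (∑ x ∈ A, (outDegree (A ∪ W) x : ℝ) ^ isoExponent) / 2 ^ n +
        cubeMeasure W * (n : ℝ) ^ isoExponent := by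
  have hiso := _root_.isoperimetric n (A ∪ W)
  have hm : cubeMeasure (A ∪ W) = cubeMeasure A + cubeMeasure W := by
    rw [cubeMeasure, Finset.card_union_of_disjoint h.2.1, Nat.cast_add, add_div]
    rfl
  rw [hm, Finset.sum_union h.2.1, add_div] at hiso
  have hW : ∑ x ∈ W, (outDegree (A ∪ W) x : ℝ) ^ isoExponent ≤ W.card * (n : ℝ) ^ isoExponent := by
    rw [← nsmul_eq_mul]
    refine Finset.sum_le_card_nsmul _ _ _ fun x _ => ?_
    exact Real.rpow_le_rpow (by positivity) (by exact_mod_cast outDegree_le _ x)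
      isoExponent_pos.le
  refine hiso.trans (add_le_add le_rfl ?_)
  rw [cubeMeasure, div_mul_eq_mul_div]
  gcongr

/-! ### From the β-th moment to the number of edges -/

theorem natCast_rpow_isoExponent_le (d : ℕ) : (d : ℝ) ^ isoExponent ≤ d := by
  rcases Nat.eq_zero_or_pos d with rfl | hd
  · simp [Real.zero_rpow isoExponent_pos.ne']
  · exact Real.rpow_le_self_of_one_le (by exact_mod_cast hd) isoExponent_lt_one.le

/-- The tangent line of `t ↦ t ^ β` at `2`. -/
theorem rpow_isoExponent_le_tangent {t : ℝ} (ht : 0 ≤ t) :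
    t ^ isoExponent ≤ 3 / 2 * (1 - isoExponent) + 3 / 4 * isoExponent * t := by
  have h := rpow_one_add_le_one_add_mul_self (s := t / 2 - 1) (by linarith)
    isoExponent_pos.le isoExponent_lt_one.le
  have e : t = 2 * (1 + (t / 2 - 1)) := by ring
  rw [e, Real.mul_rpow (by norm_num) (by linarith), two_rpow_isoExponent]
  linarith

theorem mainTheorem6 :
    ∃ C : ℝ, 0 < C ∧
      ∀ k : ℕ, k = 1 ∨ k = 2 →
      ∀ n : ℕ, 1 ≤ n → ∀ ε : ℝ, 0 < ε →
      ∀ A B W : Finset (Fin n → Bool), IsCubePartition A B W →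
        (1 - ε) * (2 : ℝ) ^ (-(k : ℤ)) ≤ cubeMeasure A →
        cubeMeasure A ≤ (1 + ε) * (2 : ℝ) ^ (-(k : ℤ)) →
        cubeMeasure W ≤ ε * (n : ℝ) ^ (-Real.logb 2 (3 / 2)) →
        ((edgesBetween A B).card : ℝ) < (1 + ε) * k * (2 : ℝ) ^ ((n : ℤ) - (k : ℤ)) →
        (1 - C * ε) * k * (2 : ℝ) ^ ((n : ℤ) - (k : ℤ)) < ((edgesBetween A B).card : ℝ) := by
  refine ⟨64, by norm_num, ?_⟩
  intro k hk n hn ε hε A B W hP hA₁ hA₂ hW _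
  have hN : (0 : ℝ) < 2 ^ n := by positivity
  have hn1 : (1 : ℝ) ≤ n := by exact_mod_cast hn
  have hβ := half_lt_isoExponent
  have hβ1 := isoExponent_lt_one
  change cubeMeasure W ≤ ε * (n : ℝ) ^ (-isoExponent) at hW
  have hiso := hP.isoperimetric
  have hW0 : 0 ≤ cubeMeasure W := div_nonneg (Nat.cast_nonneg _) hN.le
  have hA0 : 0 ≤ cubeMeasure A := div_nonneg (Nat.cast_nonneg _) hN.le
  have hWn : cubeMeasure W * (n : ℝ) ^ isoExponent ≤ ε := by
    have hpos : 0 < (n : ℝ) ^ isoExponent := by positivity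
    rw [Real.rpow_neg (by positivity), ← div_eq_mul_inv, le_div_iff₀ hpos] at hW
    exact hW
  have hWε : cubeMeasure W ≤ ε := by
    have hone := Real.one_le_rpow hn1 isoExponent_pos.le
    nlinarith
  have hAW : cubeMeasure A + cubeMeasure W ≤ 1 := by
    refine le_trans (le_of_eq ?_) (cubeMeasure_le_one (A ∪ W))
    rw [cubeMeasure, cubeMeasure, cubeMeasure, Finset.card_union_of_disjoint hP.2.1, Nat.cast_add,
      add_div]
  have hE : ((edgesBetween A B).card : ℝ) = ∑ x ∈ A, (outDegree (A ∪ W) x : ℝ) := by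
    exact_mod_cast hP.card_edgesBetween
  set E := ((edgesBetween A B).card : ℝ) / 2 ^ n with hEdef
  have hcard : ((edgesBetween A B).card : ℝ) = E * 2 ^ n := by rw [hEdef]; field_simp
  rw [zpow_sub₀ two_ne_zero, zpow_natCast, zpow_natCast, hcard]
  suffices hmain : (1 - 64 * ε) * k * (1 / 2 ^ k) < E by
    calc _ = (1 - 64 * ε) * k * (1 / 2 ^ k) * 2 ^ n := by ring
      _ < _ := by gcongr
  rw [zpow_neg, zpow_natCast] at hA₁ hA₂
  obtain ⟨a, ha⟩ : ∃ a, cubeMeasure A = a := ⟨_, rfl⟩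
  have ha' : (A.card : ℝ) / 2 ^ n = a := ha
  rw [ha] at hiso hA0 hAW hA₁ hA₂
  generalize cubeMeasure W = w at *
  -- a + w lies within 2ε of c, and t ↦ 2t(1 - t) has slope at most 2 in absolute value on [0, 1].
  have hlip : ∀ c : ℝ, 0 ≤ c → c ≤ 1 / 2 → (1 - ε) * c ≤ a → a ≤ (1 + ε) * c →
      2 * c * (1 - c) - 4 * ε ≤ 2 * (a + w) * (1 - (a + w)) := by
    intro c hc0 hc h₁ h₂
    have hl : c - ε ≤ a + w := by nlinarith
    have hr : a + w ≤ c + 2 * ε := by nlinarith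
    rcases le_total c (a + w) with h | h <;> nlinarith
  rcases hk with rfl | rfl
  · have h₁ := hlip (1 / 2) (by norm_num) le_rfl (by linarith) (by linarith)
    have h₂ : (∑ x ∈ A, (outDegree (A ∪ W) x : ℝ) ^ isoExponent) / 2 ^ n ≤ E := by
      rw [hEdef, hE]
      gcongr with x _
      exact natCast_rpow_isoExponent_le _
    norm_num
    linarith
  · have h₁ := hlip (1 / 4) (by norm_num) (by norm_num) (by linarith) (by linarith)
    -- The tangent at 2 loses nothing in the extremal case h = 2: with a = 1/4 and E = 1/2 the right
    -- side is 3/8 = 2 · (1/4) · (3/4).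
    have h₂ : (∑ x ∈ A, (outDegree (A ∪ W) x : ℝ) ^ isoExponent) / 2 ^ n ≤
        3 / 2 * (1 - isoExponent) * (A.card / 2 ^ n) + 3 / 4 * isoExponent * E := by
      rw [hEdef, hE, ← mul_div_assoc, ← mul_div_assoc, ← add_div]
      gcongr
      refine (Finset.sum_le_sum fun x _ =>
        rpow_isoExponent_le_tangent (Nat.cast_nonneg (outDegree (A ∪ W) x))).trans_eq ?_
      rw [Finset.sum_add_distrib, Finset.sum_const, nsmul_eq_mul, ← Finset.mul_sum]
      ring
    rw [ha'] at h₂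
    have h₃ : (1 - isoExponent) * a ≤ (1 - isoExponent) * (1 / 4 + ε / 4) :=
      mul_le_mul_of_nonneg_left (by linarith) (by linarith)
    -- The total error is at most 5ε + (3/8)(1 - β)ε; dividing by 3/4 leaves less than 8ε < 16βε, as
    -- β > 1/2.
    have h₄ : isoExponent * (1 / 2 - 16 * ε) < isoExponent * E := by nlinarith
    have h₅ := lt_of_mul_lt_mul_left h₄ isoExponent_pos.le
    norm_num
    linarith
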